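/- A p-algebra is a bounded distributive lattice with a unary operation $^*$ such that $x\wedge y=0$ iff $x\le y^*$. Let $\bar{\mathbf B}_2$ be the four-element Boolean algebra with a new top element added above the old one, regarded as a p-algebra, and let $\mathsf{Pa}_2=\mathbf{HSP}(\bar{\mathbf B}_2)$ be the variety it generates. For a finite poset $X$ let $\varepsilon(X)$ be the p-algebra of upsets of $X$ ordered by inclusion, with $U^*=\{x\in X:\ \text{no } y\ge x \text{ lies in } U\}$, and let $\mathbf Q(\mathbf A)$ be the quasivariety of p-algebras generated by $\mathbf A$. Let $M=\{1,2,3\}$, and for a family $\mathcal F$ of non-empty subsets of $M$ let $P(M,\mathcal F)=\{M,\{1\},\{2\},\{3\}\}\cup\mathcal F$, ordered by reverse inclusion. Put $$P=P\big(M,\{\{1,2\}\}\big),\qquad Q=P\big(M,\{\{1,2\},\{2,3\}\}\big),\qquad R=P\big(M,\{\{1,2\},\{2,3\},\{1,3\}\}\big).$$ **Theorem.** $$\mathsf{Pa}_2\subsetneq\mathbf Q(\varepsilon(R))\subsetneq\mathbf Q(\varepsilon(Q))\subsetneq\mathbf Q(\varepsilon(P)),$$ and $\mathbf Q(\varepsilon(R))$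 is a cover of $\mathsf{Pa}_2$ in the lattice of quasivarieties of p-algebras. Consequently, neither $\mathbf Q(\varepsilon(Q))$ nor $\mathbf Q(\varepsilon(P))$ is a cover of $\mathsf{Pa}_2$; that is, among $P,Q,R$ only $R$ generates a cover. -/

import Mathlib

universe u v

/-- A (distributive) p-algebra: a bounded distributive lattice with a unary operation `ᶜ`
(the pseudocomplement, written `*` on paper) such that `x ⊓ y = ⊥` iff `x ≤ yᶜ`. -/
class PAlgebra (α : Type u) extends DistribLattice α, BoundedOrder α, Compl α where
  inf_eq_bot_iff : ∀ x y : α, x ⊓ y = ⊥ ↔ x ≤ yᶜ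

/-- The class `Pa` of all p-algebras (trivial ones included). -/
structure PAlg : Type (u + 1) where
  carrier : Type u
  [str : PAlgebra carrier]

namespace PAlg

instance : CoeSort PAlg.{u} (Type u) := ⟨PAlg.carrier⟩

instance (A : PAlg.{u}) : PAlgebra A := A.str

/-- Homomorphisms of p-algebras. -/
structure IsHom {α : Type u} {β : Type v} [PAlgebra α] [PAlgebra β] (f : α → β) : Prop where
  map_bot : f ⊥ = ⊥
  map_top : f ⊤ = ⊤
  map_inf : ∀ x y, f (x ⊓ y) = f x ⊓ f y
  map_sup : ∀ x y, f (x ⊔ y) = f x ⊔ f y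
  map_compl : ∀ x, f xᶜ = (f x)ᶜ

/-- The power `A ^ I`, with pointwise operations. -/
instance piPAlgebra (I : Type v) (α : Type u) [PAlgebra α] : PAlgebra (I → α) where
  inf_eq_bot_iff x y := by
    constructor
    · intro h i
      exact (PAlgebra.inf_eq_bot_iff (x i) (y i)).1 (congrFun h i)
    · intro h
      funext i
      exact (PAlgebra.inf_eq_bot_iff (x i) (y i)).2 (h i)

/-! ### Identities, quasi-identities and quasivarieties -/

/-- Terms in the language of p-algebras, with variables `x₀, x₁, …`. -/
inductive Term : Type
  | var : ℕ → Term
  | bot : Term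
  | top : Term
  | inf : Term → Term → Term
  | sup : Term → Term → Term
  | star : Term → Term

/-- The value of a term under an assignment of the variables. -/
def Term.eval {α : Type u} [PAlgebra α] (e : ℕ → α) : Term → α
  | .var n => e n
  | .bot => ⊥
  | .top => ⊤
  | .inf s t => s.eval e ⊓ t.eval e
  | .sup s t => s.eval e ⊔ t.eval e
  | .star s => (s.eval e)ᶜ

/-- A quasi-identity `s₁ = t₁ ∧ … ∧ sₙ = tₙ → s = t` (with `n = 0` allowed). -/
structure QuasiIdentity : Type where
  premises : List (Term × Term)
  lhs : Term
  rhs : Term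

/-- `A ⊨ q`: the quasi-identity `q` is valid in `A`. -/
def Satisfies (A : PAlg.{u}) (q : QuasiIdentity) : Prop :=
  ∀ e : ℕ → A, (∀ p ∈ q.premises, p.1.eval e = p.2.eval e) → q.lhs.eval e = q.rhs.eval e

/-- A quasivariety of p-algebras: the class of all p-algebras satisfying some set of
quasi-identities. -/
def IsQuasivariety (K : Set PAlg.{u}) : Prop :=
  ∃ S : Set QuasiIdentity, K = {A | ∀ q ∈ S, A.Satisfies q}

/-- `𝐐(A)`, the quasivariety generated by `A`: all p-algebras that satisfy every quasi-identity
valid in `A`. -/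
def Q (A : PAlg.{v}) : Set PAlg.{u} :=
  {B | ∀ q : QuasiIdentity, A.Satisfies q → B.Satisfies q}

theorem isQuasivariety_Q (A : PAlg.{v}) : IsQuasivariety (Q.{u, v} A) :=
  ⟨{q | A.Satisfies q}, rfl⟩

/-- `𝐐(A)` is the least quasivariety that contains `A`. -/
theorem isLeast_Q (A : PAlg.{u}) : IsLeast {K : Set PAlg.{u} | IsQuasivariety K ∧ A ∈ K} (Q A) := by
  refine ⟨⟨isQuasivariety_Q A, fun q hq => hq⟩, ?_⟩
  rintro K ⟨⟨S, rfl⟩, hA⟩ B hB q hq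
  exact hB q (hA q hq)

/-- `K ≺ L`: `L` covers `K` in the lattice of quasivarieties of p-algebras. -/
def IsCover (K L : Set PAlg.{u}) : Prop :=
  IsQuasivariety K ∧ IsQuasivariety L ∧ K ⊂ L ∧
    ∀ K' : Set PAlg.{u}, IsQuasivariety K' → K ⊆ K' → K' ⊆ L → K' = K ∨ K' = L

/-! ### The varieties `Pa_k` -/

/-- `𝐇𝐒𝐏(A)`: homomorphic images of algebras embeddable in powers of `A`. -/
def HSP (A : PAlg.{v}) : Set PAlg.{u} :=
  {B | ∃ (I : Type (max u v)) (C : PAlg.{max u v}) (f : C → (I → A)) (g : C → B),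
    IsHom f ∧ Function.Injective f ∧ IsHom g ∧ Function.Surjective g}

open Classical in
/-- A Boolean algebra with a new top element added above the old one. -/
noncomputable def addTop (β : Type u) [BooleanAlgebra β] : PAlg.{u} where
  carrier := WithTop β
  str :=
    { (inferInstance : DistribLattice (WithTop β)),
      (inferInstance : BoundedOrder (WithTop β)) with
      compl := fun x =>
        match x with
        | ⊤ => ⊥
        | (b : β) => if b = ⊥ then ⊤ else ((bᶜ : β) : WithTop β)
      inf_eq_bot_iff := by
        intro x y
        induction y using WithTop.recTopCoe with
        | top =>
          change x ⊓ ⊤ = ⊥ ↔ x ≤ ⊥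
          simp
        | coe b =>
          change x ⊓ (b : WithTop β) = ⊥ ↔
            x ≤ (if b = ⊥ then ⊤ else ((bᶜ : β) : WithTop β))
          split_ifs with hb
          · subst hb
            simp
          · induction x using WithTop.recTopCoe with
            | top => simpa using hb
            | coe a =>
              rw [← WithTop.coe_inf, ← WithTop.coe_bot, WithTop.coe_inj, WithTop.coe_le_coe,
                ← disjoint_iff, le_compl_iff_disjoint_right] }

/-- `B̄_k`: the Boolean algebra with `k` atoms, with an extra cover of its top element. -/
noncomputable def Bbar (k : ℕ) : PAlg.{0} := addTop (Set (Fin k))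

/-- `Pa_k = 𝐇𝐒𝐏(B̄_k)`. -/
def Pa (k : ℕ) : Set PAlg.{u} := HSP.{u, 0} (Bbar k)

/-! ### Dual p-algebras of posets -/

/-- The set of upsets of a poset `X`. -/
def Upset (X : Type u) [PartialOrder X] : Type u := {U : Set X // IsUpperSet U}

/-- `ε(X)`: the p-algebra of upsets of `X` ordered by inclusion, with intersection, union, `∅`,
`X`, and `U* = {x | no element above x lies in U}`. -/
def eps (X : Type u) [PartialOrder X] : PAlg.{u} where
  carrier := Upset X
  str :=
    { le := fun U V => U.1 ⊆ V.1
      le_refl := fun U => Set.Subset.refl U.1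
      le_trans := fun _ _ _ h k => Set.Subset.trans h k
      le_antisymm := fun _ _ h k => Subtype.ext (Set.Subset.antisymm h k)
      sup := fun U V => ⟨U.1 ∪ V.1, U.2.union V.2⟩
      inf := fun U V => ⟨U.1 ∩ V.1, U.2.inter V.2⟩
      le_sup_left := fun _ _ => Set.subset_union_left
      le_sup_right := fun _ _ => Set.subset_union_right
      sup_le := fun _ _ _ h k => Set.union_subset h k
      inf_le_left := fun _ _ => Set.inter_subset_left
      inf_le_right := fun _ _ => Set.inter_subset_right
      le_inf := fun _ _ _ h k => Set.subset_inter h k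
      le_sup_inf := fun U V W => (Set.union_inter_distrib_left U.1 V.1 W.1).symm.subset
      bot := ⟨∅, isUpperSet_empty⟩
      bot_le := fun U => Set.empty_subset U.1
      top := ⟨Set.univ, isUpperSet_univ⟩
      le_top := fun U => Set.subset_univ U.1
      compl := fun U => ⟨{x | ∀ y, x ≤ y → y ∉ U.1}, fun _ _ hxy hx z hz => hx z (hxy.trans hz)⟩
      inf_eq_bot_iff := by
        intro U V
        constructor
        · intro h x hx y hxy hy
          have hm : y ∈ U.1 ∩ V.1 := ⟨U.2 hxy hx, hy⟩
          have h' : U.1 ∩ V.1 = ∅ := congrArg Subtype.val h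
          rw [h'] at hm
          exact hm
        · intro h
          apply Subtype.ext
          apply Set.eq_empty_of_forall_notMem
          rintro x ⟨hxU, hxV⟩
          exact h hxU x le_rfl hxV }

/-! ### Reduced posets -/

/-- The (finite) reduced poset `P(M, F)` with base `M`: its elements are the set `M`, the
singletons `{m}` for `m ∈ M`, and the members of `F`. -/
def Reduced (M : Type u) [Fintype M] [DecidableEq M] (F : Finset (Finset M)) : Type u :=
  {A : Finset M // A = Finset.univ ∨ (∃ m : M, A = {m}) ∨ A ∈ F}

/-- `P(M, F)` is ordered by reverse inclusion. -/
instance (M : Type u) [Fintype M] [DecidableEq M] (F : Finset (Finset M)) :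
    PartialOrder (Reduced M F) where
  le A B := B.1 ⊆ A.1
  le_refl A := Finset.Subset.refl A.1
  le_trans _ _ _ h k := Finset.Subset.trans k h
  le_antisymm _ _ h k := Subtype.ext (Finset.Subset.antisymm k h)

/-- The base `M = {1, 2, 3}` is `Fin 3`, in which the numeral `3` denotes the element `0`.
`PosetP` is `P(M, {{1,2}})`. -/
abbrev PosetP : Type := Reduced (Fin 3) {{1, 2}}

/-- `P(M, {{1,2}, M - {1}})`. -/
abbrev PosetQ : Type := Reduced (Fin 3) {{1, 2}, Finset.univ \ {1}}

/-- `P(M, {{1,2}, M - {1}, M - {2}})`. -/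
abbrev PosetR : Type := Reduced (Fin 3) {{1, 2}, Finset.univ \ {1}, Finset.univ \ {2}}

end PAlg

universe w

/-!
The class `Pa_k` is singled out by Lee's identity `(L_k)`, which says that at most `k` maximal
filters lie above any prime filter: collapsing the prime filter to the top and recording which of
these maximal filters contain an element represents the algebra in a power of `B̄_k`.
In particular `Pa_k` is the quasivariety generated by `B̄_k`.

In `ε(P(M, F))`, a family of `|M|` pairwise disjoint elements violates Lee's identity only if its
members contain the maximal elements of `P(M, F)` in some order, one each. The regularity of the
join of two members then detects whether the corresponding pair belongs to `P(M, F)`. The number of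
pairs in `F` tells the quasivarieties of `P`, `Q` and `R` apart. The inclusions between them come
from order-preserving maps of posets that preserve the maximal elements above each point.

For the cover, let `A` lie in the quasivariety of `ε(R)` but outside `Pa_2`, and take three pairwise
disjoint elements of `A` that violate Lee's identity, enlarged so that their join is dense. Every
non-empty subset of `{1, 2, 3}` is an element of `R`, and sending it to the regular element spanned
by the corresponding elements of `A` extends to a homomorphism from `ε(R)` to `A`. It is injective
because `ε(R)`, hence `A`, satisfies the quasi-identities that prevent such a regular element from
lying below the join of the pseudocomplements of the elements it is spanned by.
-/

namespace PAlg

open Finset Function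

section Pseudocomplement

variable {α : Type u} [PAlgebra α] {x y : α}

theorem le_compl_iff_disjoint : x ≤ yᶜ ↔ Disjoint x y :=
  (PAlgebra.inf_eq_bot_iff x y).symm.trans disjoint_iff.symm

theorem disjoint_compl_right : Disjoint x xᶜ := (le_compl_iff_disjoint.1 le_rfl).symm

theorem le_compl_compl : x ≤ xᶜᶜ := le_compl_iff_disjoint.2 disjoint_compl_right

theorem compl_anti (h : x ≤ y) : yᶜ ≤ xᶜ :=
  le_compl_iff_disjoint.2 (disjoint_compl_right.symm.mono_right h)

theorem compl_eq_bot_of_le (hxy : x ≤ y) (hxy' : xᶜ ≤ y) : yᶜ = ⊥ :=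
  disjoint_self.1 (disjoint_compl_right.mono (compl_anti hxy) (compl_anti hxy'))

theorem compl_bot : (⊥ : α)ᶜ = ⊤ := top_le_iff.1 (le_compl_iff_disjoint.2 disjoint_bot_right)

theorem compl_top : (⊤ : α)ᶜ = ⊥ := top_disjoint.1 disjoint_compl_right

theorem disjoint_compl_compl_left_iff : Disjoint xᶜᶜ y ↔ Disjoint x y :=
  ⟨Disjoint.mono_left le_compl_compl, fun h =>
    disjoint_compl_right.symm.mono_right (le_compl_iff_disjoint.2 h.symm)⟩

theorem compl_compl_inf_compl_compl_le : xᶜᶜ ⊓ yᶜᶜ ≤ (x ⊓ y)ᶜᶜ := by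
  rw [le_compl_iff_disjoint, disjoint_assoc, disjoint_compl_compl_left_iff, disjoint_left_comm,
    disjoint_compl_compl_left_iff, disjoint_left_comm, ← disjoint_assoc]
  exact disjoint_compl_right

theorem le_compl_finsetSup_iff {ι : Type*} {s : Finset ι} {f : ι → α} :
    x ≤ (s.sup f)ᶜ ↔ ∀ i ∈ s, Disjoint x (f i) :=
  le_compl_iff_disjoint.trans Finset.disjoint_sup_right

theorem exists_disjoint_dense_ge {ι : Type*} [Fintype ι] [Nonempty ι] {x : ι → α}
    (hx : Pairwise (Disjoint on x)) :
    ∃ y : ι → α, x ≤ y ∧ Pairwise (Disjoint on y) ∧ (univ.sup y)ᶜ = ⊥ := by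
  classical
  obtain ⟨i₀⟩ := ‹Nonempty ι›
  set z := (univ.sup x)ᶜ
  let w : ι → α := fun i => if i = i₀ then z else ⊥
  have hw : ∀ i, w i ≤ z := fun i => ite_le_sup z ⊥ _ |>.trans (sup_le le_rfl bot_le)
  have hw_self : w i₀ = z := if_pos rfl
  have hxw : ∀ i j, Disjoint (x i) (w j) := fun i j =>
    disjoint_compl_right.mono (le_sup (mem_univ i)) (hw j)
  have hw_bot : ∀ i, i ≠ i₀ → w i = ⊥ := fun i hi => if_neg hi
  have hww : Pairwise (Disjoint on w) := by
    intro i j hij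
    rcases eq_or_ne i i₀ with rfl | hi
    · exact disjoint_bot_right.mono_right (hw_bot j hij.symm).le
    · exact disjoint_bot_left.mono_left (hw_bot i hi).le
  refine ⟨x ⊔ w, le_sup_left, fun i j hij => ?_, ?_⟩
  · exact disjoint_sup_left.2 ⟨disjoint_sup_right.2 ⟨hx hij, hxw i j⟩,
      disjoint_sup_right.2 ⟨(hxw j i).symm, hww hij⟩⟩
  · have hz : z ≤ univ.sup (x ⊔ w) :=
      calc z = w i₀ := hw_self.symm
        _ ≤ x i₀ ⊔ w i₀ := le_sup_right
        _ ≤ univ.sup (x ⊔ w) := le_sup (f := x ⊔ w) (mem_univ i₀)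
    have hx' : univ.sup x ≤ univ.sup (x ⊔ w) := Finset.sup_mono_fun fun _ _ => le_sup_left
    exact compl_eq_bot_of_le hx' hz

end Pseudocomplement

section Homomorphisms

variable {α : Type u} {β : Type v} [PAlgebra α] [PAlgebra β]

theorem IsHom.map_finsetSup {f : α → β} (hf : IsHom f) {ι : Type*} (s : Finset ι) (x : ι → α) :
    f (s.sup x) = s.sup fun i => f (x i) :=
  Finset.apply_sup_eq_sup_comp f hf.map_sup hf.map_bot

theorem IsHom.eval {f : α → β} (hf : IsHom f) (e : ℕ → α) (t : Term) :
    t.eval (fun n => f (e n)) = f (t.eval e) := by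
  induction t with
  | var n => rfl
  | bot => exact hf.map_bot.symm
  | top => exact hf.map_top.symm
  | inf s t hs ht => simp only [Term.eval, hs, ht, hf.map_inf]
  | sup s t hs ht => simp only [Term.eval, hs, ht, hf.map_sup]
  | star s hs => simp only [Term.eval, hs, hf.map_compl]

theorem Satisfies.of_separating {A : PAlg.{u}} {B : PAlg.{v}} {I : Type*} {f : I → B → A}
    (hf : ∀ i, IsHom (f i)) (hsep : ∀ x y, (∀ i, f i x = f i y) → x = y) {q : QuasiIdentity}
    (hq : A.Satisfies q) : B.Satisfies q := by
  intro e he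
  refine hsep _ _ fun i => ?_
  rw [← (hf i).eval, ← (hf i).eval]
  exact hq _ fun p hp => by rw [(hf i).eval, (hf i).eval, he p hp]

theorem Satisfies.of_injective {A : PAlg.{u}} {B : PAlg.{v}} {f : B → A} (hf : IsHom f)
    (hinj : Injective f) {q : QuasiIdentity} (hq : A.Satisfies q) : B.Satisfies q :=
  hq.of_separating (I := Unit) (fun _ => hf) fun _ _ h => hinj (h ())

theorem IsHom.id : IsHom (id : α → α) :=
  ⟨rfl, rfl, fun _ _ => rfl, fun _ _ => rfl, fun _ => rfl⟩

theorem isHom_pi {I : Type*} {f : α → I → β} : IsHom f ↔ ∀ i, IsHom fun x => f x i where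
  mp hf i := ⟨congrFun hf.map_bot i, congrFun hf.map_top i, fun x y => congrFun (hf.map_inf x y) i,
    fun x y => congrFun (hf.map_sup x y) i, fun x => congrFun (hf.map_compl x) i⟩
  mpr hf := ⟨funext fun i => (hf i).map_bot, funext fun i => (hf i).map_top,
    fun x y => funext fun i => (hf i).map_inf x y, fun x y => funext fun i => (hf i).map_sup x y,
    fun x => funext fun i => (hf i).map_compl x⟩

theorem satisfies_pi_iff {A : PAlg.{u}} {I : Type v} [Nonempty I] {q : QuasiIdentity} :
    (⟨I → A⟩ : PAlg).Satisfies q ↔ A.Satisfies q :=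
  ⟨Satisfies.of_injective (A := ⟨I → A⟩) (isHom_pi.2 fun _ => .id) const_injective,
    Satisfies.of_separating (B := ⟨I → A⟩) (isHom_pi.1 .id) fun _ _ => funext⟩

theorem Q_subset_Q_iff {A : PAlg.{v}} {B : PAlg.{w}} :
    Q.{max u v} A ⊆ Q B ↔ ∀ q, B.Satisfies q → A.Satisfies q := by
  refine ⟨fun h q hq => ?_, fun h _ hC q hq => hC q (h q hq)⟩
  have hA : (⟨PUnit.{u + 1} → A⟩ : PAlg.{max u v}) ∈ Q B := h fun _ => satisfies_pi_iff.2
  exact satisfies_pi_iff.1 (hA q hq)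

theorem Q_ssubset_Q {A : PAlg.{v}} {B : PAlg.{w}} (h : ∀ q, B.Satisfies q → A.Satisfies q)
    {q : QuasiIdentity} (hA : A.Satisfies q) (hB : ¬ B.Satisfies q) : Q.{max u v w} A ⊂ Q B :=
  ⟨Q_subset_Q_iff.{max u w}.2 h, fun hBA => hB (Q_subset_Q_iff.{max u v}.1 hBA q hA)⟩

theorem not_isCover_of_ssubset_of_ssubset {K L N : Set PAlg.{u}} (hL : IsQuasivariety L)
    (hKL : K ⊂ L) (hLN : L ⊂ N) : ¬ IsCover K N := fun h =>
  (h.2.2.2 L hL hKL.subset hLN.subset).elim hKL.ne' hLN.ne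

end Homomorphisms

section LeeQuasiIdentities

variable {α : Type u} [PAlgebra α] {A : PAlg.{u}} {n k : ℕ}

/-- The join of the finite family of terms `t i`, `i ∈ s`. -/
noncomputable def Term.finsetSup {ι : Type*} (s : Finset ι) (t : ι → Term) : Term :=
  (s.toList.map t).foldr Term.sup Term.bot

theorem Term.eval_finsetSup {ι : Type*} (s : Finset ι) (t : ι → Term) (e : ℕ → α) :
    (Term.finsetSup s t).eval e = s.sup fun i => (t i).eval e := by
  have eval_foldr : ∀ l : List ι, ((l.map t).foldr Term.sup Term.bot).eval e =
      (l.map fun i => (t i).eval e).foldr (· ⊔ ·) ⊥ := by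
    intro l
    induction l with
    | nil => rfl
    | cons i l ih => exact congrArg ((t i).eval e ⊔ ·) ih
  rw [Term.finsetSup, eval_foldr, Finset.sup_def, ← Finset.coe_toList s, Multiset.map_coe]
  simp only [Multiset.sup, Multiset.coe_fold_r]

/-- The quasi-identity with premises `xᵢ ∧ xⱼ = 0` for `i ≠ j < n` and those of `l`, and with
conclusion `x₀* ∨ ⋯ ∨ xₙ₋₁* = 1`. -/
noncomputable def leeQuasiIdentity (n : ℕ) (l : List (Term × Term)) : QuasiIdentity where
  premises := (univ : Finset (Fin n)).offDiag.toList.map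
    (fun p => (.inf (.var p.1) (.var p.2), .bot)) ++ l
  lhs := .finsetSup univ fun i : Fin n => .star (.var i)
  rhs := .top

theorem satisfies_leeQuasiIdentity_iff {l : List (Term × Term)} :
    A.Satisfies (leeQuasiIdentity n l) ↔
      ∀ e : ℕ → A, (Pairwise fun i j : Fin n => Disjoint (e i) (e j)) →
        (∀ p ∈ l, p.1.eval e = p.2.eval e) → (univ.sup fun i : Fin n => (e i)ᶜ) = ⊤ := by
  refine forall_congr' fun e => ?_
  simp only [leeQuasiIdentity, List.forall_mem_append, List.forall_mem_map, mem_toList,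
    mem_offDiag, mem_univ, true_and, Prod.forall, Term.eval_finsetSup, and_imp, Term.eval,
    Pairwise, disjoint_iff]

theorem forall_comp_val_iff {p : (Fin n → α) → Prop} :
    (∀ e : ℕ → α, p fun i => e i) ↔ ∀ x, p x :=
  ⟨fun h x => by simpa only [Fin.val_injective.extend_apply] using h (extend Fin.val x ⊥),
    fun h _ => h _⟩

/-- `IsLee k α`: the p-algebra `α` belongs to the `k`-th class of Lee's chain of varieties. Lee's
identity `(L_k)` is encoded as the equivalent condition on `k + 1` pairwise disjoint elements. -/
def IsLee (k : ℕ) (α : Type u) [PAlgebra α] : Prop :=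
  ∀ x : Fin (k + 1) → α, Pairwise (Disjoint on x) → (univ.sup fun i => (x i)ᶜ) = ⊤

theorem isLee_iff_satisfies : IsLee k A ↔ A.Satisfies (leeQuasiIdentity (k + 1) []) := by
  rw [satisfies_leeQuasiIdentity_iff, IsLee, ← forall_comp_val_iff]
  simp only [List.not_mem_nil, IsEmpty.forall_iff, implies_true, true_imp_iff]

/-- Premises saying that `xᵢ ∨ xⱼ` is regular, that is, equal to its double pseudocomplement, for
each pair `(i, j)` in the list. -/
def regularJoins (E : List (Fin n × Fin n)) : List (Term × Term) :=
  E.map fun p => (.star (.star (.sup (.var p.1) (.var p.2))), .sup (.var p.1) (.var p.2))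

theorem satisfies_leeQuasiIdentity_regularJoins_iff {E : List (Fin n × Fin n)} :
    A.Satisfies (leeQuasiIdentity n (regularJoins E)) ↔
      ∀ x : Fin n → A, Pairwise (Disjoint on x) →
        (∀ p ∈ E, (x p.1 ⊔ x p.2)ᶜᶜ = x p.1 ⊔ x p.2) → (univ.sup fun i => (x i)ᶜ) = ⊤ := by
  rw [satisfies_leeQuasiIdentity_iff, ← forall_comp_val_iff]
  simp only [regularJoins, List.forall_mem_map]
  rfl

end LeeQuasiIdentities

section PrimeFilters

variable {α : Type u} [PAlgebra α]

/-- A prime filter of a p-algebra, encoded by its membership predicate, which is a homomorphism of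
bounded lattices to the two-element lattice `Prop`. -/
abbrev PrimeFilter (α : Type u) [PAlgebra α] : Type u := BoundedLatticeHom α Prop

namespace PrimeFilter

variable {F M N : PrimeFilter α} {x y : α}

theorem mem_inf_iff : F (x ⊓ y) ↔ F x ∧ F y := (map_inf F x y).to_iff

theorem mem_sup_iff : F (x ⊔ y) ↔ F x ∨ F y := (map_sup F x y).to_iff

theorem mem_top : F ⊤ := (map_top F).to_iff.2 trivial

theorem notMem_bot : ¬ F ⊥ := (map_bot F).to_iff.1

theorem mem_finsetInf_iff {ι : Type*} {s : Finset ι} {f : ι → α} :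
    F (s.inf f) ↔ ∀ i ∈ s, F (f i) := by
  rw [map_finset_inf, Finset.inf_eq_iInf]
  simp only [iInf_Prop_eq, comp_apply]

theorem mem_finsetSup_iff {ι : Type*} {s : Finset ι} {f : ι → α} :
    F (s.sup f) ↔ ∃ i ∈ s, F (f i) := by
  rw [map_finset_sup, Finset.sup_eq_iSup]
  simp only [iSup_Prop_eq, comp_apply, exists_prop]

theorem mem_of_le (h : x ≤ y) : F x → F y := OrderHomClass.mono F h

theorem not_mem_and_mem_compl : ¬ (F x ∧ F xᶜ) := fun h =>
  notMem_bot (F := F) (mem_of_le disjoint_compl_right.le_bot (mem_inf_iff.2 h))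

theorem exists_of_notMem {G : Order.PFilter α} (h : y ∉ G) :
    ∃ F : PrimeFilter α, (∀ z ∈ G, F z) ∧ ¬ F y := by
  have hdisj : Disjoint (G : Set α) (Order.Ideal.principal y : Set α) :=
    Set.disjoint_left.2 fun z hz hzy => h (Order.PFilter.mem_of_le hzy hz)
  obtain ⟨J, hJ, hyJ, hGJ⟩ := DistribLattice.prime_ideal_of_disjoint_filter_ideal hdisj
  have hy : y ∈ J := hyJ (Order.Ideal.mem_principal.2 le_rfl)
  refine ⟨⟨⟨⟨fun z => z ∉ J, fun a b => ?_⟩, fun a b => ?_⟩, ?_, ?_⟩,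
    fun z hz => Set.disjoint_left.1 hGJ hz, not_not_intro hy⟩
  · exact propext (by simp only [Order.Ideal.sup_mem_iff, not_and_or]; rfl)
  · exact propext ⟨fun hab => ⟨mt (J.lower inf_le_left) hab, mt (J.lower inf_le_right) hab⟩,
      fun hab hab' => (hJ.mem_or_mem hab').elim hab.1 hab.2⟩
  · exact propext (iff_true_intro hJ.top_notMem)
  · exact propext (iff_false_intro (not_not_intro J.bot_mem))

theorem exists_of_not_le (h : ¬ x ≤ y) : ∃ F : PrimeFilter α, F x ∧ ¬ F y :=
  (exists_of_notMem (G := Order.PFilter.principal x) h).imp fun _ hF =>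
    ⟨hF.1 x (Order.PFilter.mem_principal.2 le_rfl), hF.2⟩

theorem eq_of_forall_mem_iff (h : ∀ F : PrimeFilter α, F x ↔ F y) : x = y := by
  refine le_antisymm ?_ ?_ <;> by_contra hxy <;> obtain ⟨F, hF⟩ := exists_of_not_le hxy
  · exact hF.2 ((h F).1 hF.1)
  · exact hF.2 ((h F).2 hF.1)

/-- A prime filter is maximal among the proper filters iff it contains each element or its
pseudocomplement. -/
def IsMaximal (M : PrimeFilter α) : Prop := ∀ x, M x ∨ M xᶜ

theorem IsMaximal.mem_compl_iff (hM : IsMaximal M) : M xᶜ ↔ ¬ M x :=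
  ⟨fun h h' => not_mem_and_mem_compl ⟨h', h⟩, (hM x).resolve_left⟩

theorem IsMaximal.exists_mem_mem_compl (hM : IsMaximal M) (hN : IsMaximal N) (h : M ≠ N) :
    ∃ a, M a ∧ N aᶜ := by
  by_contra! hMN
  have hle : ∀ a, M a → N a := fun a ha => (hN a).resolve_right (hMN a ha)
  refine h (DFunLike.ext _ _ fun a => propext ⟨hle a, fun ha => (hM a).resolve_right fun ha' => ?_⟩)
  exact not_mem_and_mem_compl ⟨ha, hle _ ha'⟩

theorem exists_isMaximal_ge (hx : ¬ F xᶜ) : ∃ M, IsMaximal M ∧ ⇑F ≤ M ∧ M x := by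
  -- The double pseudocomplement makes the filter contain every dense element.
  let G : Set α := {z | ∃ f, F f ∧ f ⊓ x ≤ zᶜᶜ}
  have hG : Order.IsPFilter G := by
    refine Order.IsPFilter.of_def ⟨⊤, ⊤, mem_top, le_top.trans le_compl_compl⟩ ?_ ?_
    · rintro a ⟨f, hf, hfa⟩ b ⟨g, hg, hgb⟩
      refine ⟨a ⊓ b, ⟨f ⊓ g, mem_inf_iff.2 ⟨hf, hg⟩, ?_⟩, inf_le_left, inf_le_right⟩
      calc f ⊓ g ⊓ x = f ⊓ x ⊓ (g ⊓ x) := inf_inf_distrib_right f g x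
        _ ≤ aᶜᶜ ⊓ bᶜᶜ := inf_le_inf hfa hgb
        _ ≤ (a ⊓ b)ᶜᶜ := compl_compl_inf_compl_compl_le
    · rintro a b hab ⟨f, hf, hfa⟩
      exact ⟨f, hf, hfa.trans (compl_anti (compl_anti hab))⟩
  have mem_G {z : α} : z ∈ hG.toPFilter ↔ ∃ f, F f ∧ f ⊓ x ≤ zᶜᶜ := Iff.rfl
  have hbot : ⊥ ∉ hG.toPFilter := by
    rw [mem_G, compl_bot, compl_top]
    rintro ⟨f, hf, hfx⟩
    exact hx (mem_of_le (le_compl_iff_disjoint.2 (disjoint_iff_inf_le.2 hfx)) hf)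
  have hdense (z : α) : z ⊔ zᶜ ∈ hG.toPFilter := by
    rw [mem_G, compl_eq_bot_of_le le_sup_left le_sup_right, compl_bot]
    exact ⟨⊤, mem_top, le_top⟩
  obtain ⟨M, hGM, -⟩ := exists_of_notMem hbot
  exact ⟨M, fun z => mem_sup_iff.1 (hGM _ (hdense z)),
    fun f hf => hGM f ⟨f, hf, inf_le_left.trans le_compl_compl⟩,
    hGM x ⟨⊤, mem_top, inf_le_right.trans le_compl_compl⟩⟩

end PrimeFilter

end PrimeFilters

section AddTop

variable {β : Type u} [BooleanAlgebra β]

/-- The embedding, not preserving the top, of a Boolean algebra `β` in `addTop β`. -/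
def addTop.ofBase (b : β) : addTop β := WithTop.some b

theorem addTop.compl_ofBase {b : β} (hb : b ≠ ⊥) : (addTop.ofBase b)ᶜ = addTop.ofBase bᶜ :=
  if_neg hb

theorem addTop.eq_top_or_exists_ofBase (x : addTop β) : x = ⊤ ∨ ∃ b : β, x = addTop.ofBase b :=
  WithTop.recTopCoe (.inl rfl) (fun b => .inr ⟨b, rfl⟩) x

theorem addTop.disjoint_ofBase_iff {a b : β} :
    Disjoint (addTop.ofBase a) (addTop.ofBase b) ↔ Disjoint a b := by
  rw [disjoint_iff, disjoint_iff]
  exact WithTop.coe_inj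

end AddTop

section SubdirectRepresentation

open PrimeFilter

variable {α : Type u} [PAlgebra α] {β : Type v} [PAlgebra β] {k : ℕ}

open Classical in
/-- The map to a Boolean algebra of sets with an added top that collapses the prime filter `F` to
the top and sends any other `x` to the set of those `M i` that contain `x`. It is a homomorphism
when the `M i` are the maximal filters above `F`. -/
noncomputable def toAddTop {ι : Type v} (F : PrimeFilter α) (M : ι → PrimeFilter α) (x : α) :
    addTop (Set ι) :=
  if F x then ⊤ else addTop.ofBase {i | M i x}

theorem toAddTop_eq_top_iff {ι : Type v} {F : PrimeFilter α} {M : ι → PrimeFilter α} {x : α} :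
    toAddTop F M x = ⊤ ↔ F x := by
  by_cases hx : F x
  · simp only [toAddTop, hx, if_true]
  · simp only [toAddTop, hx, if_false, iff_false]
    exact WithTop.coe_ne_top

theorem isHom_toAddTop {ι : Type v} {F : PrimeFilter α} {M : ι → PrimeFilter α}
    (hM : ∀ i, IsMaximal (M i)) (hFM : ∀ i, ⇑F ≤ M i)
    (hF : ∀ x, (∀ i, ¬ M i x) → F xᶜ) : IsHom (toAddTop F M) where
  map_bot := by
    simp only [toAddTop, notMem_bot, if_false, Set.ofPred_false]
    rfl
  map_top := if_pos mem_top
  map_inf x y := by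
    by_cases hx : F x <;> by_cases hy : F y
    · simp only [toAddTop, mem_inf_iff, hx, hy, and_self, if_true, inf_idem]
    · simp only [toAddTop, mem_inf_iff, hx, hy, hFM _ x hx, true_and, if_true, if_false, top_inf_eq]
    · simp only [toAddTop, mem_inf_iff, hx, hy, hFM _ y hy, and_true, if_true, if_false, inf_top_eq]
    · simp only [toAddTop, mem_inf_iff, hx, hy, false_and, if_false]
      rfl
  map_sup x y := by
    by_cases hx : F x
    · simp only [toAddTop, mem_sup_iff, hx, true_or, if_true, top_sup_eq]
    by_cases hy : F y
    · simp only [toAddTop, mem_sup_iff, hy, or_true, if_true, sup_top_eq]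
    · simp only [toAddTop, mem_sup_iff, hx, hy, or_self, if_false]
      rfl
  map_compl x := by
    have hcompl : {i | M i xᶜ} = {i | M i x}ᶜ := Set.ext fun i => (hM i).mem_compl_iff
    by_cases hx : F x
    · have hx' : ¬ F xᶜ := fun h => not_mem_and_mem_compl ⟨hx, h⟩
      simp only [toAddTop, hx, hx', (hM _).mem_compl_iff, hFM _ x hx, not_true, if_true, if_false,
        Set.ofPred_false]
      exact compl_top.symm
    rcases Set.eq_empty_or_nonempty {i | M i x} with hempty | ⟨i, hi⟩
    · have hx' : F xᶜ := hF x fun i => Set.eq_empty_iff_forall_notMem.1 hempty i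
      simp only [toAddTop, hx, hx', hempty, if_true, if_false]
      exact compl_bot.symm
    · have hx' : ¬ F xᶜ := fun h => not_mem_and_mem_compl ⟨hi, hFM i _ h⟩
      simp only [toAddTop, hx, hx', if_false, hcompl]
      exact (addTop.compl_ofBase (Set.nonempty_iff_ne_empty.1 ⟨i, hi⟩)).symm

theorem IsLee.not_injective (hα : IsLee k α) {F : PrimeFilter α}
    {M : Fin (k + 1) → PrimeFilter α} (hM : ∀ i, IsMaximal (M i)) (hFM : ∀ i, ⇑F ≤ M i) :
    ¬ Injective M := by
  intro hinj
  have hsep : ∀ i j, ∃ a, i ≠ j → M i a ∧ M j aᶜ := fun i j => by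
    by_cases hij : i = j
    · exact ⟨⊥, fun h => absurd hij h⟩
    · obtain ⟨a, ha⟩ := (hM i).exists_mem_mem_compl (hM j) (hinj.ne hij)
      exact ⟨a, fun _ => ha⟩
  choose a ha using hsep
  let x i := (univ.erase i).inf fun j => a i j ⊓ (a j i)ᶜ
  have hx_le : ∀ i j, i ≠ j → x i ≤ a i j ⊓ (a j i)ᶜ := fun i j hij =>
    inf_le (f := fun j => a i j ⊓ (a j i)ᶜ) (mem_erase.2 ⟨hij.symm, mem_univ j⟩)
  have hdisj : Pairwise (Disjoint on x) := fun i j hij =>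
    disjoint_compl_right.mono ((hx_le i j hij).trans inf_le_left)
      ((hx_le j i hij.symm).trans inf_le_right)
  have hMx : ∀ i, M i (x i) := fun i => mem_finsetInf_iff.2 fun j hj =>
    have hji := (mem_erase.1 hj).1
    mem_inf_iff.2 ⟨(ha i j hji.symm).1, (ha j i hji).2⟩
  have hFtop : F (univ.sup fun i => (x i)ᶜ) := (hα x hdisj).symm ▸ mem_top
  obtain ⟨i, -, hi⟩ := mem_finsetSup_iff.1 hFtop
  exact not_mem_and_mem_compl ⟨hMx i, hFM i _ hi⟩

theorem IsLee.exists_maximal_enumeration (hα : IsLee k α) (F : PrimeFilter α) :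
    ∃ M : Fin k → PrimeFilter α, (∀ i, IsMaximal (M i)) ∧ (∀ i, ⇑F ≤ M i) ∧
      ∀ N, IsMaximal N → ⇑F ≤ N → ∃ i, M i = N := by
  let S := {M : PrimeFilter α // IsMaximal M ∧ ⇑F ≤ M}
  have : Nonempty S := by
    obtain ⟨M, hM, hFM, -⟩ := exists_isMaximal_ge (F := F) (x := ⊤)
      (compl_top (α := α) ▸ notMem_bot)
    exact ⟨⟨M, hM, hFM⟩⟩
  have hlt : Cardinal.mk S < (k + 1 : ℕ) := by
    by_contra! hle
    obtain ⟨f⟩ : Nonempty (Fin (k + 1) ↪ S) := Cardinal.lift_mk_le'.1 (by simpa using hle)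
    exact hα.not_injective (fun i => (f i).2.1) (fun i => (f i).2.2)
      (Subtype.val_injective.comp f.injective)
  rw [Nat.cast_succ, ← Cardinal.succ_natCast, Order.lt_succ_iff] at hlt
  obtain ⟨g⟩ : Nonempty (S ↪ Fin k) := Cardinal.lift_mk_le'.1 (by simpa using hlt)
  refine ⟨fun i => (invFun g i).1, fun i => (invFun g i).2.1, fun i => (invFun g i).2.2,
    fun N hN hFN => ?_⟩
  obtain ⟨i, hi⟩ := invFun_surjective g.injective ⟨N, hN, hFN⟩
  exact ⟨i, congrArg Subtype.val hi⟩

theorem IsLee.exists_separating_homs (hα : IsLee k α) :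
    ∃ f : PrimeFilter α → α → Bbar k, (∀ F, IsHom (f F)) ∧
      ∀ x y, (∀ F, f F x = f F y) → x = y := by
  choose M hM hFM hsurj using hα.exists_maximal_enumeration
  refine ⟨fun F => toAddTop F (M F), fun F => isHom_toAddTop (hM F) (hFM F) fun x hx => ?_,
    fun x y hxy => eq_of_forall_mem_iff fun F => ?_⟩
  · by_contra hFx
    obtain ⟨N, hN, hFN, hNx⟩ := exists_isMaximal_ge hFx
    obtain ⟨i, rfl⟩ := hsurj F N hN hFN
    exact hx i hNx
  · exact toAddTop_eq_top_iff.symm.trans ((hxy F).congr_left.trans toAddTop_eq_top_iff)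

theorem isLee_Bbar [NeZero k] : IsLee k (Bbar k) := by
  intro x hx
  by_contra hne
  have hbot : ∀ i, x i ≠ ⊥ := fun i hi => hne <| top_unique <|
    compl_bot.ge.trans (hi ▸ le_sup (f := fun i => (x i)ᶜ) (mem_univ i))
  have : Nontrivial (Fin (k + 1)) :=
    Fin.nontrivial_iff_two_le.2 (Nat.succ_le_succ NeZero.one_le)
  have hbase : ∀ i, ∃ b : Set (Fin k), x i = addTop.ofBase b := fun i => by
    refine (addTop.eq_top_or_exists_ofBase (x i)).resolve_left fun hi => ?_
    obtain ⟨j, hj⟩ := exists_ne i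
    exact hbot j (top_disjoint.1 (hi ▸ hx hj.symm))
  choose b hb using hbase
  have hnonempty : ∀ i, (b i).Nonempty := fun i =>
    Set.nonempty_iff_ne_empty.2 fun h => hbot i ((hb i).trans (congrArg addTop.ofBase h))
  choose a ha using hnonempty
  have ha_inj : Injective a := fun i j hij => by
    by_contra hne
    have hdisj : Disjoint (b i) (b j) := addTop.disjoint_ofBase_iff.1 (hb i ▸ hb j ▸ hx hne)
    exact Set.disjoint_left.1 hdisj (ha i) (hij ▸ ha j)
  exact absurd (Fintype.card_le_of_injective a ha_inj) (by simp)

theorem IsLee.of_surjective (hα : IsLee k α) {g : α → β} (hg : IsHom g) (hsurj : Surjective g) :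
    IsLee k β := by
  intro x hx
  choose c hc using fun i => hsurj (x i)
  let d i := c i ⊓ ((Iio i).sup c)ᶜ
  have hd_lt : ∀ i j, i < j → Disjoint (d i) (d j) := fun i j hij =>
    disjoint_compl_right.mono (inf_le_left.trans (le_sup (mem_Iio.2 hij))) inf_le_right
  have hd : Pairwise (Disjoint on d) := fun i j hij =>
    hij.lt_or_gt.elim (hd_lt i j) fun hji => (hd_lt j i hji).symm
  have hgd : ∀ i, g (d i) = x i := fun i => by
    rw [hg.map_inf, hg.map_compl, hg.map_finsetSup, inf_eq_left.2] <;> simp only [hc]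
    exact le_compl_finsetSup_iff.2 fun j hj => hx (mem_Iio.1 hj).ne'
  calc (univ.sup fun i => (x i)ᶜ) = univ.sup fun i => g (d i)ᶜ := by simp only [hg.map_compl, hgd]
    _ = g (univ.sup fun i => (d i)ᶜ) := (hg.map_finsetSup _ _).symm
    _ = ⊤ := by rw [hα d hd, hg.map_top]

theorem mem_Pa_iff [NeZero k] {A : PAlg.{u}} : A ∈ Pa.{u} k ↔ IsLee k A := by
  refine ⟨?_, fun hA => ?_⟩
  · rintro ⟨I, C, f, g, hf, hf_inj, hg, hg_surj⟩
    refine IsLee.of_surjective (isLee_iff_satisfies.2 ?_) hg hg_surj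
    exact (isLee_iff_satisfies.1 isLee_Bbar).of_separating (f := fun i x => f x i)
      (isHom_pi.1 hf) fun x y h => hf_inj (funext h)
  · obtain ⟨f, hf, hsep⟩ := hA.exists_separating_homs
    refine ⟨PrimeFilter A, A, fun x F => f F x, id, isHom_pi.2 hf, fun x y hxy => ?_, IsHom.id,
      surjective_id⟩
    exact hsep x y (congrFun hxy)

theorem Pa_eq_Q [NeZero k] : Pa.{u} k = Q.{u, 0} (Bbar k) := by
  ext A
  rw [mem_Pa_iff]
  constructor
  · intro hA q hq
    obtain ⟨f, hf, hsep⟩ := hA.exists_separating_homs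
    exact hq.of_separating hf hsep
  · exact fun hA => isLee_iff_satisfies.2 (hA _ (isLee_iff_satisfies.1 isLee_Bbar))

end SubdirectRepresentation

section Upsets

open PrimeFilter

variable {X : Type u} [PartialOrder X] {α : Type v} [PAlgebra α]

namespace eps

instance : Membership X (eps X) := ⟨fun U x => x ∈ U.1⟩

variable {U V : eps X} {x y : X}

@[ext] theorem ext (h : ∀ x, x ∈ U ↔ x ∈ V) : U = V := Subtype.ext (Set.ext h)

theorem le_iff : U ≤ V ↔ ∀ x ∈ U, x ∈ V := Iff.rfl

theorem mem_inf_iff : x ∈ U ⊓ V ↔ x ∈ U ∧ x ∈ V := Iff.rfl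

theorem mem_sup_iff : x ∈ U ⊔ V ↔ x ∈ U ∨ x ∈ V := Iff.rfl

theorem mem_top : x ∈ (⊤ : eps X) := trivial

theorem notMem_bot : x ∉ (⊥ : eps X) := id

theorem mem_of_le (hxy : x ≤ y) (hx : x ∈ U) : y ∈ U := U.2 hxy hx

theorem disjoint_iff : Disjoint U V ↔ ∀ x, x ∈ U → x ∉ V := by
  rw [_root_.disjoint_iff, eps.ext_iff]
  exact forall_congr' fun x => by simp only [mem_inf_iff, notMem_bot, iff_false, not_and]

/-- The prime filter of all upsets that contain the point `x`. -/
def pointFilter (x : X) : PrimeFilter (eps X) where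
  toFun U := x ∈ U
  map_sup' _ _ := rfl
  map_inf' _ _ := rfl
  map_top' := rfl
  map_bot' := rfl

theorem mem_finsetSup_iff {ι : Type*} {s : Finset ι} {f : ι → eps X} :
    x ∈ s.sup f ↔ ∃ i ∈ s, x ∈ f i :=
  PrimeFilter.mem_finsetSup_iff (F := pointFilter x)

end eps

/-- The map to the upset algebra of `X` that is dual to a monotone family `p` of prime filters. -/
def toEps (p : X → PrimeFilter α) (hp : ∀ x y, x ≤ y → ⇑(p x) ≤ p y) (a : α) : eps X :=
  ⟨{x | p x a}, fun x y hxy => hp x y hxy a⟩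

theorem isHom_toEps {p : X → PrimeFilter α} (hp : ∀ x y, x ≤ y → ⇑(p x) ≤ p y)
    (hcompl : ∀ x a, ¬ p x aᶜ → ∃ y, x ≤ y ∧ p y a) : IsHom (toEps p hp) where
  map_bot := eps.ext fun _ => iff_false_intro notMem_bot
  map_top := eps.ext fun _ => iff_true_intro PrimeFilter.mem_top
  map_inf _ _ := eps.ext fun _ => PrimeFilter.mem_inf_iff
  map_sup _ _ := eps.ext fun _ => PrimeFilter.mem_sup_iff
  map_compl a := by
    refine eps.ext fun x => ⟨fun hx y hxy hy => not_mem_and_mem_compl ⟨hy, hp x y hxy _ hx⟩, ?_⟩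
    contrapose!
    intro hx h
    obtain ⟨y, hxy, hy⟩ := hcompl x a hx
    exact h y hxy hy

end Upsets

section ReducedPosets

variable {M : Type u} [Fintype M] [DecidableEq M] {F : Finset (Finset M)}
variable {N : Type v} [Fintype N] [DecidableEq N] {G : Finset (Finset N)}

namespace Reduced

/-- The condition for a set to be an element of the reduced poset `P(M, F)`. -/
abbrev IsMember (F : Finset (Finset M)) (S : Finset M) : Prop :=
  S = univ ∨ (∃ m, S = {m}) ∨ S ∈ F

/-- Every element of `P(M, F)` is a non-empty set. -/
abbrev IsProper (F : Finset (Finset M)) : Prop := ∀ S, IsMember F S → S.Nonempty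

/-- The elements of `P(M, F)` are all the non-empty subsets of `M`. -/
abbrev IsFull (F : Finset (Finset M)) : Prop := ∀ S, IsMember F S ↔ S.Nonempty

/-- The maximal element `{m}` of `P(M, F)`. -/
def single (m : M) : Reduced M F := ⟨{m}, .inr (.inl ⟨m, rfl⟩)⟩

/-- The least element `M` of `P(M, F)`. -/
def base : Reduced M F := ⟨univ, .inl rfl⟩

theorem le_single_iff {x : Reduced M F} {m : M} : x ≤ single m ↔ m ∈ x.1 :=
  Finset.singleton_subset_iff

theorem eq_single_of_single_le (hF : IsProper F) {x : Reduced M F} {m : M} (h : single m ≤ x) :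
    x = single m :=
  Subtype.ext ((hF x.1 x.2).subset_singleton_iff.1 h)

theorem mem_compl_iff (hF : IsProper F) {U : eps (Reduced M F)} {x : Reduced M F} :
    x ∈ Uᶜ ↔ ∀ m ∈ x.1, single m ∉ U := by
  refine ⟨fun hx m hm => hx _ (le_single_iff.2 hm), fun hx y hxy hy => ?_⟩
  obtain ⟨m, hm⟩ := hF y.1 y.2
  exact hx m (hxy hm) (eps.mem_of_le (le_single_iff.2 hm) hy)

theorem mem_compl_compl_iff (hF : IsProper F) {U : eps (Reduced M F)} {x : Reduced M F} :
    x ∈ Uᶜᶜ ↔ ∀ m ∈ x.1, single m ∈ U := by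
  rw [mem_compl_iff hF]
  refine forall₂_congr fun m _ => ?_
  rw [mem_compl_iff hF, not_forall]
  exact ⟨fun ⟨i, hi⟩ => by
      rw [Classical.not_imp, not_not] at hi
      exact mem_singleton.1 hi.1 ▸ hi.2,
    fun h => ⟨m, not_imp_of_and_not ⟨mem_singleton_self m, not_not_intro h⟩⟩⟩

theorem satisfies_of_jointly_surjective {I : Type*} {τ : I → M → N} (hG : IsProper G)
    (hτ : ∀ i S, IsMember F S → IsMember G (S.image (τ i)))
    (hsurj : ∀ T, IsMember G T → ∃ i S, IsMember F S ∧ S.image (τ i) = T) {q : QuasiIdentity}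
    (hq : (eps (Reduced M F)).Satisfies q) : (eps (Reduced N G)).Satisfies q := by
  let f (i : I) (x : Reduced M F) : Reduced N G := ⟨x.1.image (τ i), hτ i x.1 x.2⟩
  let p i x := eps.pointFilter (f i x)
  have hp i : ∀ x y, x ≤ y → ⇑(p i x) ≤ p i y := fun x y hxy U =>
    eps.mem_of_le (image_subset_image (f := τ i) hxy)
  have hom i : IsHom (toEps (p i) (hp i)) := isHom_toEps (hp i) fun x U hx => by
    obtain ⟨n, hn, hnU⟩ : ∃ n ∈ x.1.image (τ i), single n ∈ U := by
      simpa only [not_forall, exists_prop, not_not] using mt (mem_compl_iff hG).2 hx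
    obtain ⟨m, hm, rfl⟩ := mem_image.1 hn
    exact ⟨single m, le_single_iff.2 hm, hnU⟩
  refine hq.of_separating hom fun U V hUV => eps.ext fun y => ?_
  obtain ⟨i, S, hS, hST⟩ := hsurj y.1 y.2
  obtain rfl : f i ⟨S, hS⟩ = y := Subtype.ext hST
  exact eps.ext_iff.1 (hUV i) ⟨S, hS⟩

theorem satisfies_of_isFull (hF : IsProper F) (hG : IsFull G)
    (hcard : Fintype.card N ≤ Fintype.card M) {q : QuasiIdentity}
    (hq : (eps (Reduced M F)).Satisfies q) : (eps (Reduced N G)).Satisfies q := by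
  refine satisfies_of_jointly_surjective (τ := id) (fun T => (hG T).1)
    (fun τ S hS => (hG _).2 ((hF S hS).image τ)) (fun T hT => ?_) hq
  obtain ⟨t, ht⟩ := (hG T).1 hT
  have : Nonempty T := ⟨t, ht⟩
  obtain ⟨g⟩ : Nonempty (T ↪ M) := Embedding.nonempty_of_card_le
    ((Fintype.card_coe T).trans_le ((card_le_univ T).trans hcard))
  refine ⟨fun m => (invFun g m).1, univ, .inl rfl, ?_⟩
  ext n
  simp only [mem_image, mem_univ, true_and, id_eq]
  constructor
  · rintro ⟨m, rfl⟩
    exact (invFun g m).2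
  · intro hn
    obtain ⟨m, hm⟩ := invFun_surjective g.injective ⟨n, hn⟩
    exact ⟨m, congrArg Subtype.val hm⟩

theorem exists_perm_of_finsetSup_compl_ne_top (hF : IsProper F) {U : M → eps (Reduced M F)}
    (hU : Pairwise (Disjoint on U)) (htop : (univ.sup fun i => (U i)ᶜ) ≠ ⊤) :
    ∃ σ : Equiv.Perm M, ∀ i m, single m ∈ U i ↔ m = σ i := by
  obtain ⟨x, hx⟩ : ∃ x, x ∉ univ.sup fun i => (U i)ᶜ := by
    by_contra! h
    exact htop (eps.ext fun x => iff_of_true (h x) eps.mem_top)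
  have hsingle : ∀ i, ∃ m, single m ∈ U i := fun i => by
    by_contra! h
    exact hx (eps.mem_finsetSup_iff.2 ⟨i, mem_univ i, (mem_compl_iff hF).2 fun m _ => h m⟩)
  choose σ hσ using hsingle
  have hσ_unique : ∀ {i j}, single (σ j) ∈ U i → i = j := fun {i j} hij => by
    by_contra hne
    exact eps.disjoint_iff.1 (hU hne) _ hij (hσ j)
  have hσ_inj : Injective σ := fun i j hij => hσ_unique (hij ▸ hσ i)
  have hσ_bij : Bijective σ := Finite.injective_iff_bijective.1 hσ_inj
  refine ⟨Equiv.ofBijective σ hσ_bij, fun i m => ⟨fun hm => ?_, ?_⟩⟩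
  · obtain ⟨j, rfl⟩ := hσ_bij.surjective m
    exact congrArg σ (hσ_unique hm).symm
  · rintro rfl
    exact hσ i

variable {k n : ℕ}

theorem base_le (x : Reduced M F) : base ≤ x := subset_univ x.1

theorem base_ne_single [Nontrivial M] (m : M) : (base : Reduced M F) ≠ single m := fun h => by
  obtain ⟨m', hm'⟩ := exists_ne m
  exact hm' (mem_singleton.1 (le_single_iff.1 (h ▸ base_le (single m'))))

theorem eq_base_or_exists_eq_single (x : Reduced M ∅) : x = base ∨ ∃ m, x = single m := by
  rcases x with ⟨S, rfl | ⟨m, rfl⟩ | hS⟩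
  · exact .inl rfl
  · exact .inr ⟨m, rfl⟩
  · exact absurd hS (notMem_empty S)

theorem single_injective : Injective (single : M → Reduced M F) := fun _ _ h =>
  singleton_injective (congrArg Subtype.val h)

theorem satisfies_of_isLee {A : PAlg.{u}} (hA : IsLee k A) (hk : 2 ≤ k)
    {q : QuasiIdentity} (hq : (eps (Reduced (Fin k) ∅)).Satisfies q) : A.Satisfies q := by
  have : Nontrivial (Fin k) := Fin.nontrivial_iff_two_le.2 hk
  choose M hM hFM hsurj using hA.exists_maximal_enumeration
  let p F : Reduced (Fin k) ∅ → PrimeFilter A := extend single (M F) fun _ => F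
  have hp_base F : p F base = F :=
    extend_apply' _ _ _ fun ⟨i, hi⟩ => base_ne_single i hi.symm
  have hp_single F i : p F (single i) = M F i := single_injective.extend_apply _ _ i
  have hp F : ∀ x y, x ≤ y → ⇑(p F x) ≤ p F y := by
    intro x y hxy
    rcases eq_base_or_exists_eq_single x with rfl | ⟨i, rfl⟩
    · rcases eq_base_or_exists_eq_single y with rfl | ⟨j, rfl⟩
      · exact le_rfl
      · rw [hp_base, hp_single]
        exact hFM F j
    · rcases eq_base_or_exists_eq_single y with rfl | ⟨j, rfl⟩
      · exact absurd ((base_le _).antisymm hxy) (base_ne_single i)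
      · rw [mem_singleton.1 (le_single_iff.1 hxy)]
  have hcompl F : ∀ x a, ¬ p F x aᶜ → ∃ y, x ≤ y ∧ p F y a := by
    intro x a hx
    rcases eq_base_or_exists_eq_single x with rfl | ⟨i, rfl⟩
    · rw [hp_base] at hx
      obtain ⟨N, hN, hFN, hNa⟩ := PrimeFilter.exists_isMaximal_ge hx
      obtain ⟨i, rfl⟩ := hsurj F N hN hFN
      exact ⟨single i, base_le _, (hp_single F i).symm ▸ hNa⟩
    · rw [hp_single] at hx
      exact ⟨single i, le_rfl, (hp_single F i).symm ▸ (hM F i a).resolve_right hx⟩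
  refine hq.of_separating (fun F => isHom_toEps (hp F) (hcompl F)) fun a b hab => ?_
  refine PrimeFilter.eq_of_forall_mem_iff fun F => ?_
  exact hp_base F ▸ eps.ext_iff.1 (hab F) base

/-- The upset whose only element is `{m}`. -/
def atom (hF : IsProper F) (m : M) : eps (Reduced M F) :=
  ⟨{single m}, fun _ _ hxy hx => eq_single_of_single_le hF (hx.ge.trans hxy)⟩

theorem compl_compl_atom_sup_atom (hF : IsProper F) {i j : M} (hij : ¬ IsMember F {i, j}) :
    (atom hF i ⊔ atom hF j)ᶜᶜ = atom hF i ⊔ atom hF j := by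
  refine le_antisymm (eps.le_iff.2 fun x hx => ?_) le_compl_compl
  have hsub : (x.1 : Set M) ⊆ {i, j} := fun m hm =>
    ((mem_compl_compl_iff hF).1 hx m hm).imp (single_injective ·) (single_injective ·)
  have hx' : x.1 = {i} ∨ x.1 = {j} ∨ x.1 = {i, j} := by
    exact_mod_cast (coe_nonempty.2 (hF x.1 x.2)).subset_pair_iff_eq.1 hsub
  rcases hx' with h | h | h
  · exact eps.mem_sup_iff.2 (.inl (Subtype.ext h))
  · exact eps.mem_sup_iff.2 (.inr (Subtype.ext h))
  · exact absurd (h ▸ x.2) hij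

theorem satisfies_leeQuasiIdentity_regularJoins_iff {F : Finset (Finset (Fin n))}
    (hF : IsProper F) {E : List (Fin n × Fin n)} (hE : ∀ p ∈ E, p.1 ≠ p.2) :
    (eps (Reduced (Fin n) F)).Satisfies (leeQuasiIdentity n (regularJoins E)) ↔
      ∀ σ : Equiv.Perm (Fin n), ∃ p ∈ E, IsMember F {σ p.1, σ p.2} := by
  rw [PAlg.satisfies_leeQuasiIdentity_regularJoins_iff]
  constructor
  · intro h σ
    by_contra hσ
    replace hσ p (hp : p ∈ E) : ¬ IsMember F {σ p.1, σ p.2} := fun h => hσ ⟨p, hp, h⟩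
    have hdisj : Pairwise (Disjoint on fun i => atom hF (σ i)) := fun i j hij =>
      eps.disjoint_iff.2 fun x hi hj => hij (σ.injective (single_injective (hi.symm.trans hj)))
    have hbase : base ∈ univ.sup fun i => (atom hF (σ i))ᶜ :=
      h _ hdisj (fun p hp => compl_compl_atom_sup_atom hF (hσ p hp)) ▸ eps.mem_top
    obtain ⟨i, -, hi⟩ := eps.mem_finsetSup_iff.1 hbase
    exact (mem_compl_iff hF).1 hi (σ i) (mem_univ _) rfl
  · intro h U hU hreg
    by_contra htop
    obtain ⟨σ, hσ⟩ := exists_perm_of_finsetSup_compl_ne_top hF hU htop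
    obtain ⟨p, hp, hmem⟩ := h σ
    let x : Reduced (Fin n) F := ⟨_, hmem⟩
    have hx : x ∈ (U p.1 ⊔ U p.2)ᶜᶜ := (mem_compl_compl_iff hF).2 fun m hm => by
      rw [eps.mem_sup_iff, hσ, hσ]
      simpa only [x, mem_insert, mem_singleton] using hm
    have hσ_eq : ∀ i, x ∈ U i → p.1 = i ∧ p.2 = i := fun i hi => by
      have hi' m (hm : m ∈ x.1) : m = σ i :=
        (hσ i m).1 (eps.mem_of_le (le_single_iff.2 hm) hi)
      exact ⟨σ.injective (hi' _ (mem_insert_self _ _)),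
        σ.injective (hi' _ (mem_insert_of_mem (mem_singleton_self _)))⟩
    rw [hreg p hp, eps.mem_sup_iff] at hx
    exact hx.elim (fun h => hE p hp (hσ_eq _ h).2.symm) fun h => hE p hp (hσ_eq _ h).1

end Reduced

end ReducedPosets

section RegularHull

open Reduced

variable {M : Type v} [Fintype M] [DecidableEq M] {G : Finset (Finset M)}
variable {α : Type u} [PAlgebra α] {x : M → α} {y : α} {S T : Finset M} {m : M}

/-- The regular element `¬ ⋁_{m ∉ S} x m`. If the `x m` are pairwise disjoint with dense join, it
is the double pseudocomplement of `⋁_{m ∈ S} x m`. -/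
def regularHull (x : M → α) (S : Finset M) : α := (Sᶜ.sup x)ᶜ

theorem le_regularHull_iff : y ≤ regularHull x S ↔ ∀ m ∉ S, Disjoint y (x m) := by
  simp only [regularHull, le_compl_finsetSup_iff, mem_compl]

theorem regularHull_inf : regularHull x S ⊓ regularHull x T = regularHull x (S ∩ T) := by
  refine eq_of_forall_le_iff fun y => ?_
  simp only [le_inf_iff, le_regularHull_iff, mem_inter, not_and_or, or_imp, forall_and]

theorem regularHull_univ : regularHull x univ = ⊤ :=
  top_le_iff.1 (le_regularHull_iff.2 fun m hm => absurd (mem_univ m) hm)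

theorem regularHull_empty (hx : (univ.sup x)ᶜ = ⊥) : regularHull x ∅ = ⊥ := by
  rw [regularHull, Finset.compl_empty, hx]

theorem le_regularHull (hx : Pairwise (Disjoint on x)) (hm : m ∈ S) : x m ≤ regularHull x S :=
  le_regularHull_iff.2 fun _ hm' => hx fun h => hm' (h ▸ hm)

open Classical in
/-- The extension of `regularHull x` from the elements of `P(M, G)` to the upsets of `P(M, G)`. -/
noncomputable def hullJoin (x : M → α) (U : eps (Reduced M G)) : α :=
  (univ.filter fun S => ∃ h : IsMember G S, (⟨S, h⟩ : Reduced M G) ∈ U).sup (regularHull x)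

theorem hullJoin_le_iff {U : eps (Reduced M G)} :
    hullJoin x U ≤ y ↔ ∀ z ∈ U, regularHull x z.1 ≤ y := by
  simp only [hullJoin, Finset.sup_le_iff, mem_filter, mem_univ, true_and]
  exact ⟨fun h z hz => h z.1 ⟨z.2, hz⟩, fun h S ⟨hS, hSU⟩ => h ⟨S, hS⟩ hSU⟩

theorem regularHull_le_hullJoin {U : eps (Reduced M G)} {z : Reduced M G} (hz : z ∈ U) :
    regularHull x z.1 ≤ hullJoin x U := hullJoin_le_iff.1 le_rfl z hz

theorem hullJoin_mono {U V : eps (Reduced M G)} (hUV : U ≤ V) : hullJoin x U ≤ hullJoin x V :=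
  hullJoin_le_iff.2 fun z hz => regularHull_le_hullJoin (eps.le_iff.1 hUV z hz)

theorem hullJoin_bot : hullJoin x (⊥ : eps (Reduced M G)) = ⊥ :=
  le_bot_iff.1 (hullJoin_le_iff.2 fun _ hz => absurd hz eps.notMem_bot)

theorem hullJoin_inf (hG : IsFull G) (hx : (univ.sup x)ᶜ = ⊥) (U V : eps (Reduced M G)) :
    hullJoin x (U ⊓ V) = hullJoin x U ⊓ hullJoin x V := by
  refine le_antisymm (le_inf (hullJoin_mono inf_le_left) (hullJoin_mono inf_le_right)) ?_
  simp only [hullJoin, Finset.sup_inf_sup, Finset.sup_le_iff, mem_product, mem_filter, mem_univ,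
    true_and]
  rintro ⟨S, T⟩ ⟨⟨hS, hSU⟩, hT, hTV⟩
  rw [regularHull_inf]
  rcases (S ∩ T).eq_empty_or_nonempty with hST | hST
  · exact (hST ▸ regularHull_empty hx).trans_le bot_le
  · let s : Reduced M G := ⟨S, hS⟩
    let t : Reduced M G := ⟨T, hT⟩
    let z : Reduced M G := ⟨S ∩ T, (hG _).2 hST⟩
    have hsz : s ≤ z := (inter_subset_left : S ∩ T ⊆ S)
    have htz : t ≤ z := (inter_subset_right : S ∩ T ⊆ T)
    exact regularHull_le_hullJoin (z := z)
      (eps.mem_inf_iff.2 ⟨eps.mem_of_le hsz hSU, eps.mem_of_le htz hTV⟩)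

theorem isHom_hullJoin (hG : IsFull G) (hdisj : Pairwise (Disjoint on x))
    (hx : (univ.sup x)ᶜ = ⊥) : IsHom (hullJoin x : eps (Reduced M G) → α) where
  map_bot := hullJoin_bot
  map_top := top_le_iff.1 <| regularHull_univ.ge.trans
    (regularHull_le_hullJoin (z := base) eps.mem_top)
  map_inf := hullJoin_inf hG hx
  map_sup U V := by
    refine le_antisymm (hullJoin_le_iff.2 fun z hz => ?_)
      (sup_le (hullJoin_mono le_sup_left) (hullJoin_mono le_sup_right))
    exact (eps.mem_sup_iff.1 hz).elim (fun hz => le_sup_of_le_left (regularHull_le_hullJoin hz))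
      fun hz => le_sup_of_le_right (regularHull_le_hullJoin hz)
  map_compl U := by
    classical
    refine le_antisymm (le_compl_iff_disjoint.2 ?_) ?_
    · rw [disjoint_iff, ← hullJoin_inf hG hx, disjoint_compl_right.symm.eq_bot, hullJoin_bot]
    let W := univ.filter fun m => single m ∉ U
    have hUW : (hullJoin x U)ᶜ ≤ regularHull x W := le_regularHull_iff.2 fun m hm => by
      have hmU : single m ∈ U := by
        simpa only [W, mem_filter, mem_univ, true_and, not_not] using hm
      exact disjoint_compl_right.symm.mono_right ((le_regularHull hdisj
        (mem_singleton_self m)).trans (regularHull_le_hullJoin hmU))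
    refine hUW.trans ?_
    rcases W.eq_empty_or_nonempty with hW | hW
    · rw [hW, regularHull_empty hx]
      exact bot_le
    · refine regularHull_le_hullJoin (z := ⟨W, (hG W).2 hW⟩) ?_
      exact (mem_compl_iff fun S => (hG S).1).2 fun m hm => (mem_filter.1 hm).2

theorem hullJoin_injective (hx : ∀ T : Finset M, T.Nonempty →
    ¬ regularHull x T ≤ T.sup fun i => (x i)ᶜ) (hG : IsProper G) :
    Injective (hullJoin x : eps (Reduced M G) → α) := by
  have hle : ∀ U V : eps (Reduced M G), hullJoin x U ≤ hullJoin x V → U ≤ V := by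
    refine fun U V hUV => eps.le_iff.2 fun y hy => ?_
    by_contra hyV
    refine hx y.1 (hG y.1 y.2) ((regularHull_le_hullJoin hy).trans (hUV.trans ?_))
    refine hullJoin_le_iff.2 fun z hz => ?_
    obtain ⟨i, hiy, hiz⟩ : ∃ i ∈ y.1, i ∉ z.1 := not_subset.1 fun h => hyV (eps.mem_of_le h hz)
    exact (compl_anti (le_sup (mem_compl.2 hiz))).trans (le_sup (f := fun i => (x i)ᶜ) hiy)
  exact fun U V h => (hle U V h.le).antisymm (hle V U h.ge)

end RegularHull

section Cover

open Reduced

variable {k n : ℕ} {A : PAlg.{u}}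

/-- The premise saying that `regularHull x T` lies below the join of the `(x i)ᶜ`, `i ∈ T`. -/
noncomputable def hullLePremise (T : Finset (Fin n)) : Term × Term :=
  let hull : Term := .star (.finsetSup Tᶜ fun i => .var i)
  (.inf hull (.finsetSup T fun i => .star (.var i)), hull)

theorem satisfies_leeQuasiIdentity_hullLePremise_iff {T : Finset (Fin n)} :
    A.Satisfies (leeQuasiIdentity n [hullLePremise T]) ↔
      ∀ x : Fin n → A, Pairwise (Disjoint on x) →
        (regularHull x T ≤ T.sup fun i => (x i)ᶜ) → (univ.sup fun i => (x i)ᶜ) = ⊤ := by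
  rw [satisfies_leeQuasiIdentity_iff, ← forall_comp_val_iff]
  simp only [hullLePremise, List.forall_mem_singleton, Term.eval, Term.eval_finsetSup, inf_eq_left]
  rfl

theorem satisfies_leeQuasiIdentity_hullLePremise {G : Finset (Finset (Fin n))} (hG : IsFull G)
    {T : Finset (Fin n)} (hT : T.Nonempty) :
    (eps (Reduced (Fin n) G)).Satisfies (leeQuasiIdentity n [hullLePremise T]) := by
  have hG' : IsProper G := fun S => (hG S).1
  refine satisfies_leeQuasiIdentity_hullLePremise_iff.2 fun U hU hle => ?_
  by_contra htop
  obtain ⟨σ, hσ⟩ := exists_perm_of_finsetSup_compl_ne_top hG' hU htop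
  let y : Reduced (Fin n) G := ⟨T.image σ, (hG _).2 (hT.image σ)⟩
  have hy : y ∈ regularHull U T := (mem_compl_iff hG').2 fun m hm hmU => by
    obtain ⟨i, hi, rfl⟩ := mem_image.1 hm
    obtain ⟨j, hj, hjU⟩ := eps.mem_finsetSup_iff.1 hmU
    exact mem_compl.1 hj (σ.injective ((hσ j _).1 hjU) ▸ hi)
  obtain ⟨i, hi, hiU⟩ := eps.mem_finsetSup_iff.1 (eps.le_iff.1 hle y hy)
  exact (mem_compl_iff hG').1 hiU (σ i) (mem_image_of_mem σ hi) ((hσ i _).2 rfl)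

theorem satisfies_eps_of_not_isLee {G : Finset (Finset (Fin (k + 1)))} (hG : IsFull G)
    (hA : A ∈ Q.{u, 0} (eps (Reduced (Fin (k + 1)) G))) (hk : ¬ IsLee k A) {q : QuasiIdentity}
    (hq : A.Satisfies q) : (eps (Reduced (Fin (k + 1)) G)).Satisfies q := by
  simp only [IsLee, not_forall] at hk
  obtain ⟨x, hx, htop⟩ := hk
  obtain ⟨y, hxy, hy, hdense⟩ := exists_disjoint_dense_ge hx
  refine hq.of_injective (isHom_hullJoin hG hy hdense)
    (hullJoin_injective (fun T hT hle => htop ?_) fun S => (hG S).1)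
  have hytop := satisfies_leeQuasiIdentity_hullLePremise_iff.1
    (hA _ (satisfies_leeQuasiIdentity_hullLePremise hG hT)) y hy hle
  exact top_le_iff.1 (hytop.ge.trans (sup_mono_fun fun i _ => compl_anti (hxy i)))

theorem isCover_Pa_Q_eps [NeZero k] {G : Finset (Finset (Fin (k + 1)))} (hG : IsFull G)
    (hPa : Pa.{u} k ⊂ Q.{u, 0} (eps (Reduced (Fin (k + 1)) G))) :
    IsCover (Pa.{u} k) (Q.{u, 0} (eps (Reduced (Fin (k + 1)) G))) := by
  refine ⟨by rw [Pa_eq_Q]; exact isQuasivariety_Q _, isQuasivariety_Q _, hPa, ?_⟩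
  rintro K ⟨S, rfl⟩ hPaK hK
  refine or_iff_not_imp_left.2 fun hne => hK.antisymm fun B hB q hq => ?_
  obtain ⟨A, hAK, hA⟩ := Set.not_subset.1 fun h => hne (Set.Subset.antisymm h hPaK)
  exact hB q (satisfies_eps_of_not_isLee hG (hK hAK) (fun h => hA (mem_Pa_iff.2 h)) (hAK q hq))

end Cover

section ThreePoints

open Reduced

theorem isProper_PosetP : IsProper ({{1, 2}} : Finset (Finset (Fin 3))) := by decide

theorem isProper_PosetQ : IsProper ({{1, 2}, univ \ {1}} : Finset (Finset (Fin 3))) := by decide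

theorem isFull_PosetR : IsFull ({{1, 2}, univ \ {1}, univ \ {2}} : Finset (Finset (Fin 3))) := by
  decide

theorem isProper_PosetR : IsProper ({{1, 2}, univ \ {1}, univ \ {2}} : Finset (Finset (Fin 3))) :=
  fun S => (isFull_PosetR S).1

theorem isFull_two_empty : IsFull (∅ : Finset (Finset (Fin 2))) := by decide

theorem Pa_ssubset_Q_PosetR : Pa.{u} 2 ⊂ Q.{u, 0} (eps PosetR) := by
  rw [Pa_eq_Q]
  exact Q_ssubset_Q (q := leeQuasiIdentity 3 (regularJoins []))
    (fun _ hq => satisfies_of_isLee isLee_Bbar le_rfl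
      (satisfies_of_isFull isProper_PosetR isFull_two_empty (by decide) hq))
    (isLee_iff_satisfies.1 isLee_Bbar)
    (mt (Reduced.satisfies_leeQuasiIdentity_regularJoins_iff isProper_PosetR (by decide)).1
      (by decide))

theorem Q_PosetR_ssubset_Q_PosetQ : Q.{u, 0} (eps PosetR) ⊂ Q.{u, 0} (eps PosetQ) :=
  Q_ssubset_Q (q := leeQuasiIdentity 3 (regularJoins [(0, 2)]))
    (fun _ => satisfies_of_isFull isProper_PosetQ isFull_PosetR le_rfl)
    ((Reduced.satisfies_leeQuasiIdentity_regularJoins_iff isProper_PosetR (by decide)).2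
      (by decide))
    (mt (Reduced.satisfies_leeQuasiIdentity_regularJoins_iff isProper_PosetQ (by decide)).1
      (by decide))

theorem Q_PosetQ_ssubset_Q_PosetP : Q.{u, 0} (eps PosetQ) ⊂ Q.{u, 0} (eps PosetP) :=
  Q_ssubset_Q (q := leeQuasiIdentity 3 (regularJoins [(0, 2), (1, 2)]))
    (fun _ => satisfies_of_jointly_surjective (τ := fun b => bif b then id else Equiv.swap 0 1)
      isProper_PosetQ (by decide) (by decide))
    ((Reduced.satisfies_leeQuasiIdentity_regularJoins_iff isProper_PosetQ (by decide)).2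
      (by decide))
    (mt (Reduced.satisfies_leeQuasiIdentity_regularJoins_iff isProper_PosetP (by decide)).1
      (by decide))

end ThreePoints

end PAlg

theorem mainTheorem7 :
    (PAlg.Pa.{u} 2 ⊂ PAlg.Q.{u, 0} (PAlg.eps PAlg.PosetR) ∧
      PAlg.Q.{u, 0} (PAlg.eps PAlg.PosetR) ⊂ PAlg.Q.{u, 0} (PAlg.eps PAlg.PosetQ) ∧
      PAlg.Q.{u, 0} (PAlg.eps PAlg.PosetQ) ⊂ PAlg.Q.{u, 0} (PAlg.eps PAlg.PosetP)) ∧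
    PAlg.IsCover (PAlg.Pa.{u} 2) (PAlg.Q.{u, 0} (PAlg.eps PAlg.PosetR)) ∧
    ¬ PAlg.IsCover (PAlg.Pa.{u} 2) (PAlg.Q.{u, 0} (PAlg.eps PAlg.PosetQ)) ∧
    ¬ PAlg.IsCover (PAlg.Pa.{u} 2) (PAlg.Q.{u, 0} (PAlg.eps PAlg.PosetP)) := by
  have hPR := PAlg.Pa_ssubset_Q_PosetR.{u}
  have hRQ := PAlg.Q_PosetR_ssubset_Q_PosetQ.{u}
  have hQP := PAlg.Q_PosetQ_ssubset_Q_PosetP.{u}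
  have hR := PAlg.isQuasivariety_Q.{u, 0} (PAlg.eps PAlg.PosetR)
  exact ⟨⟨hPR, hRQ, hQP⟩, PAlg.isCover_Pa_Q_eps PAlg.isFull_PosetR hPR,
    PAlg.not_isCover_of_ssubset_of_ssubset hR hPR hRQ,
    PAlg.not_isCover_of_ssubset_of_ssubset hR hPR (hRQ.trans hQP)⟩
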